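/- **Setting.** A *causal diagram* $\mathcal G$ over a finite set $V$ of variables is an acyclic graph with directed arrows and bi-directed arrows between distinct nodes, together with a partition $V=O\cup L$ into observed variables $O$ and latent variables $L$. Each $v\in V$ has a fixed countable domain $\mathscr D_v$. A *partially observable structural causal model* (POSCM) $M$ consists of finitely many mutually independent exogenous variables $U$ with distribution $P(\mathbf u)$, an acyclic system of structural functions $v\leftarrow f_v(\mathrm{pa}_v,u_v)$ with $\mathrm{Pa}_v\subseteq V$, $U_v\subseteq U$ for $v \in V$, and a partition $V=O\cup L$. It *induces* the diagram that has $O$ as observed variables, an arrow $a\to b$ iff $a\in \mathrm{Pa}_b$, and a bi-directed arrow $a\leftrightarrow b$ (for $a\ne b$) iff $U_a\cap U_b\neq\emptyset$. Let $P(\cdot\,;M)$ be the distribution of the endogenous variables under $M$. Let $X\in O$ be the action and let $Y\in L\cap \mathrm{De}(X)_{\mathcal G}$ be the latent reward, where $\mathrm{De}(X)$ denotes the descendants of $X$, including $X$. A *policy space* $\Pi$ is given by covariates $\mathrm{Pa}(\Pi)\subseteq O\setminus \mathrm{De}(X)_{\mathcal G_{\overline X}}$, where $\mathcal G_{\overline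 X}$ is $\mathcal G$ without the arrows coming into $X$; it consists of all maps $\pi$ from values of $\mathrm{Pa}(\Pi)$ to probability distributions over $\mathscr D_X$. $\Pi'$ is a *subspace* of $\Pi$ if $\mathrm{Pa}(\Pi')\subseteq \mathrm{Pa}(\Pi)$. For a policy $\pi$ with covariates $\mathrm{Pa}^*$, $$P(\mathbf v\mid \mathrm{do}(\pi);M)=\sum_{\mathbf u}P(\mathbf u)\,\pi(x\mid \mathrm{pa}^*)\prod_{w\in V\setminus\{X\}}P(w\mid \mathrm{pa}_w,u_w)$$ (an integral over $\mathbf u$ if the exogenous variables are not discrete), where $P(w\mid \mathrm{pa}_w,u_w)$ is $1$ if $w=f_w(\mathrm{pa}_w,u_w)$ and $0$ otherwise. For $\mathbf T\subseteq V$, $P(\mathbf t\mid\mathrm{do}(\pi))$ is *identifiable* w.r.t. $\langle\mathcal G,\Pi\rangle$ if, for all POSCMs $M_1,M_2$ that induce $\mathcal G$ with $P(\mathbf o;M_1)=P(\mathbf o;M_2)>0$ for all $\mathbf o$, and all $\pi\in\Pi$, one has $P(\mathbf t\mid\mathrm{do}(\pi);M_1)=P(\mathbf t\mid\mathrm{do}(\pi);M_2)$.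 A subspace $\Pi'$ of $\Pi$ is an *identifiable subspace* w.r.t. $\langle\mathcal G,\Pi,\mathbf T\rangle$, where $\mathbf T\subseteq O$, if $P(\mathbf t\mid\mathrm{do}(\pi))$ is identifiable w.r.t. $\langle\mathcal G,\Pi'\rangle$. A set $\mathbf S\subseteq O$ is a *surrogate* w.r.t. $\langle\mathcal G,\Pi'\rangle$ if $\mathbf S$ d-separates $Y$ from $\hat X$ in the graph obtained from $\mathcal G$ by adding the arrows from $\mathrm{Pa}(\Pi')$ to $X$ and a new node $\hat X$ with an arrow $\hat X\to X$. For $\mathbf S\subseteq O$ and a subspace $\Pi'$ of $\Pi$, $\langle \mathbf S,\Pi'\rangle$ is an *instrument* w.r.t. $\langle\mathcal G,\Pi\rangle$ if $\mathbf S$ is a surrogate w.r.t. $\langle\mathcal G,\Pi'\rangle$ and $\Pi'$ is an identifiable subspace w.r.t. $\langle\mathcal G,\Pi,\mathbf S\rangle$. Let $\mathcal G\cup\{Y\}$ be the diagram $\mathcal G$ with $Y$ made observed. **Lemma.** Let $\mathcal G$ be a causal diagram, $\Pi$ a policy space, and $\Pi'$ a subspace of $\Pi$. If there exists $\mathbf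 S\subseteq O$ such that $\langle \mathbf S,\Pi'\rangle$ is an instrument w.r.t. $\langle\mathcal G,\Pi\rangle$, then $\Pi'$ is an identifiable subspace w.r.t. $\langle\mathcal G\cup\{Y\},\Pi,\{Y\}\rangle$. -/

import Mathlib

open scoped ENNReal

namespace CausalImitation

universe u v

noncomputable section

/-! ### Mixed graphs and d-separation -/

/-- A graph with directed arrows `a → b` and bi-directed arrows `a ↔ b` (between distinct nodes). -/
structure MixedGraph (V : Type u) where
  dir : V → V → Prop
  bi : SimpleGraph V

namespace MixedGraph

variable {V : Type u}

/-- `De(x)`: the descendants of `x`, including `x` itself. -/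
def De (G : MixedGraph V) (x : V) : Set V := {d | Relation.ReflTransGen G.dir x d}

/-- The subgraph obtained by removing all arrows that come into `x`. -/
def removeIncoming (G : MixedGraph V) (x : V) : MixedGraph V where
  dir a b := G.dir a b ∧ b ≠ x
  bi :=
    { Adj := fun a b => G.bi.Adj a b ∧ a ≠ x ∧ b ≠ x
      symm := ⟨fun _ _ h => ⟨h.1.symm, h.2.2, h.2.1⟩⟩
      loopless := ⟨fun _ h => h.1.ne rfl⟩ }

/-- An edge traversed from `a` to `b`: `a → b`, `a ← b` or `a ↔ b`. -/
inductive Step (G : MixedGraph V) : V → V → Type u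
  | fwd {a b : V} (h : G.dir a b) : Step G a b
  | bwd {a b : V} (h : G.dir b a) : Step G a b
  | bidir {a b : V} (h : G.bi.Adj a b) : Step G a b

/-- The edge has an arrowhead at the node where the traversal starts. -/
def Step.headAtStart {G : MixedGraph V} {a b : V} : Step G a b → Prop
  | .fwd _ => False
  | .bwd _ => True
  | .bidir _ => True

/-- The edge has an arrowhead at the node where the traversal ends. -/
def Step.headAtEnd {G : MixedGraph V} {a b : V} : Step G a b → Prop
  | .fwd _ => True
  | .bwd _ => False
  | .bidir _ => True

/-- A sequence of consecutive edges, traversed irrespective of their orientation. -/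
inductive Walk (G : MixedGraph V) : V → V → Type u
  | nil (a : V) : Walk G a a
  | cons {a b c : V} (e : Step G a b) (p : Walk G b c) : Walk G a c

/-- The list of visited nodes. -/
def Walk.support {G : MixedGraph V} {a b : V} : Walk G a b → List V
  | .nil a => [a]
  | .cons (a := a) _ p => a :: p.support

/-- A path visits no node more than once. -/
def Walk.IsPath {G : MixedGraph V} {a b : V} (p : Walk G a b) : Prop := p.support.Nodup

/-- The middle node `m` of two consecutive edges blocks given `Z`: either `m` is a collider
(`→ m ←`) and neither `m` nor any of its descendants is in `Z`, or `m` is the middle node of a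
chain or a fork and lies in `Z`. -/
def BlocksAt (G : MixedGraph V) (Z : Set V) {a m b : V} (e : Step G a m) (e' : Step G m b) : Prop :=
  (e.headAtEnd ∧ e'.headAtStart ∧ ∀ d ∈ G.De m, d ∉ Z) ∨
    (¬(e.headAtEnd ∧ e'.headAtStart) ∧ m ∈ Z)

/-- A walk is blocked by `Z` if one of its intermediate nodes blocks. -/
def Walk.Blocked {G : MixedGraph V} (Z : Set V) {a b : V} : Walk G a b → Prop
  | .nil _ => False
  | .cons _ (.nil _) => False
  | .cons e (.cons e' p) => G.BlocksAt Z e e' ∨ (Walk.cons e' p).Blocked Z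

/-- `(A ⫫ B | Z)_G`: every path from a node of `A` to a node of `B` is blocked by `Z`. -/
def DSep (G : MixedGraph V) (A B Z : Set V) : Prop :=
  ∀ a ∈ A, ∀ b ∈ B, ∀ p : Walk G a b, p.IsPath → p.Blocked Z

end MixedGraph

/-! ### Causal diagrams -/

/-- A causal diagram: an acyclic mixed graph with a set `obs` of observed nodes; the nodes outside
`obs` are latent. -/
structure CausalDiagram (V : Type u) extends MixedGraph V where
  acyclic : ∀ a, ¬ Relation.TransGen dir a a
  obs : Set V

namespace CausalDiagram

variable {V : Type u}

/-- `G ∪ {Y}`: the same diagram with `Y` made observed. -/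
def observe (G : CausalDiagram V) (Y : V) : CausalDiagram V where
  toMixedGraph := G.toMixedGraph
  acyclic := G.acyclic
  obs := insert Y G.obs

/-- `C` is an admissible set `Pa*` of covariates for policies over `X`, i.e. `C` determines the
policy space `{π : D_C → P_X}`. -/
def IsPolicySpace (G : CausalDiagram V) (X : V) (C : Set V) : Prop :=
  C ⊆ G.obs \ (G.toMixedGraph.removeIncoming X).De X

/-- `G ∪ Π` together with the new parent `X̂` of `X`, for the policy space `Π` with covariates `C`:
the node `none` is `X̂`, the node `some a` is the node `a` of `G`. -/
def withPolicy (G : CausalDiagram V) (X : V) (C : Set V) : MixedGraph (Option V) where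
  dir
    | none, some b => b = X
    | some a, some b => G.dir a b ∨ (a ∈ C ∧ b = X)
    | _, none => False
  bi := G.bi.map Function.Embedding.some

/-- `S` is an imitation surrogate w.r.t. `G` and the policy space with covariates `C`. -/
def IsSurrogate (G : CausalDiagram V) (X Y : V) (C S : Set V) : Prop :=
  S ⊆ G.obs ∧ (G.withPolicy X C).DSep {some Y} {none} (some '' S)

end CausalDiagram

/-! ### Partially observable structural causal models -/

/-- A structural causal model over the endogenous variables `V` with domains `D`: finitely many
mutually independent exogenous variables `U` with laws `P`, and for each `w : V` a structural function
of the endogenous arguments `pa w` and of the exogenous arguments `ex w`. -/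
structure SCM {V : Type u} (D : V → Type v) where
  U : Type
  [fintypeU : Fintype U]
  E : U → Type
  [measE : ∀ j, MeasurableSpace (E j)]
  P : ∀ j, MeasureTheory.Measure (E j)
  [probP : ∀ j, MeasureTheory.IsProbabilityMeasure (P j)]
  pa : V → Set V
  ex : V → Set U
  f : ∀ w, (∀ a : pa w, D a) → (∀ j : ex w, E j) → D w
  measurable_f : ∀ w a x, MeasurableSet {e | f w a e = x}
  acyclic : ∀ a, ¬ Relation.TransGen (fun b c => b ∈ pa c) a a

attribute [instance] SCM.fintypeU SCM.measE SCM.probP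

/-- A policy over `X` with covariates `C`: a map from values of the covariates to probability
distributions over the domain of `X`. -/
abbrev Policy {V : Type u} (D : V → Type v) (X : V) (C : Set V) : Type (max u v) :=
  (∀ a : C, D a) → PMF (D X)

namespace SCM

variable {V : Type u} {D : V → Type v}

/-- The distribution `P(u)` of the exogenous variables. -/
def exoLaw (M : SCM D) : MeasureTheory.Measure (∀ j, M.E j) := MeasureTheory.Measure.pi M.P

open Classical in
/-- `P(x_w | pa_w, u_w)`: it is `1` if the structural function of `w` returns `x w`, and `0`
otherwise. -/
def mech (M : SCM D) (x : ∀ w, D w) (u : ∀ j, M.E j) (w : V) : ℝ≥0∞ :=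
  if M.f w (fun a => x a) (fun j => u j) = x w then 1 else 0

/-- The distribution `P(v)` over all endogenous variables. -/
def joint [Fintype V] (M : SCM D) (x : ∀ w, D w) : ℝ≥0∞ :=
  ∫⁻ u, ∏ w, M.mech x u w ∂M.exoLaw

/-- The interventional distribution `P(v | do(π))` over all endogenous variables. -/
def jointDo [Fintype V] [DecidableEq V] (M : SCM D) (X : V) {C : Set V} (π : Policy D X C)
    (x : ∀ w, D w) : ℝ≥0∞ :=
  ∫⁻ u, (∏ w ∈ Finset.univ.erase X, M.mech x u w) * π (fun a => x a) (x X) ∂M.exoLaw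

end SCM

open Classical in
/-- The marginal over the variables in `T` of the mass function `p`. -/
def marginal {V : Type u} {D : V → Type v} (p : (∀ w, D w) → ℝ≥0∞) (T : Set V)
    (t : ∀ w : T, D w) : ℝ≥0∞ :=
  ∑' x : ∀ w, D w, if (∀ w : T, x w = t w) then p x else 0

/-- A partially observable SCM: an SCM with a set `obs` of observed endogenous variables, the
others being latent. -/
structure POSCM {V : Type u} (D : V → Type v) extends SCM D where
  obs : Set V

/-- The causal diagram associated with `M`: `a → b` if `a` is an argument of the function of `b`,
and `a ↔ b` if the functions of `a ≠ b` share an exogenous argument. -/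
def POSCM.diagram {V : Type u} {D : V → Type v} (M : POSCM D) : CausalDiagram V where
  dir a b := a ∈ M.pa b
  bi :=
    { Adj := fun a b => a ≠ b ∧ (M.ex a ∩ M.ex b).Nonempty
      symm := ⟨fun a b h => ⟨h.1.symm, Set.inter_comm (M.ex a) (M.ex b) ▸ h.2⟩⟩
      loopless := ⟨fun _ h => h.1 rfl⟩ }
  acyclic := M.acyclic
  obs := M.obs

/-! ### Identifiability and instruments -/

/-- `P(t | do(π))` is identifiable w.r.t. `G` and the policy space with covariates `C`: for every
policy in it, `P(t | do(π); M)` is uniquely determined by `P(o; M)`, among all models `M` which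
induce `G` and whose observational distribution `P(o; M)` is positive. -/
def Identifiable {V : Type u} [Fintype V] [DecidableEq V] (D : V → Type v) (G : CausalDiagram V)
    (X : V) (C T : Set V) : Prop :=
  ∀ M₁ M₂ : POSCM D, M₁.diagram = G → M₂.diagram = G →
    (∀ o, 0 < marginal M₁.joint G.obs o) →
    marginal M₁.joint G.obs = marginal M₂.joint G.obs →
    ∀ π : Policy D X C, marginal (M₁.jointDo X π) T = marginal (M₂.jointDo X π) T

/-- The policy space with covariates `C'` is an identifiable subspace w.r.t. `⟨G, Π, T⟩`, where `Π`
is the policy space with covariates `C` and `T` is a set of observed variables. -/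
def IsIdSubspace {V : Type u} [Fintype V] [DecidableEq V] (D : V → Type v) (G : CausalDiagram V)
    (X : V) (C T C' : Set V) : Prop :=
  G.IsPolicySpace X C ∧ T ⊆ G.obs ∧ C' ⊆ C ∧ Identifiable D G X C' T

/-- `⟨S, Π'⟩` is an imitation instrument w.r.t. `⟨G, Π⟩`, where `Π` and `Π'` are the policy spaces
with covariates `C` and `C'`. -/
def IsInstrument {V : Type u} [Fintype V] [DecidableEq V] (D : V → Type v) (G : CausalDiagram V)
    (X Y : V) (C S C' : Set V) : Prop :=
  G.IsSurrogate X Y C' S ∧ IsIdSubspace D G X C S C'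

end

end CausalImitation

/-!
The interventional distribution factors as `P(y | do(π)) = ∑ s, P(y | s, do(π)) P(s | do(π))`. The
second factor is identifiable by assumption, and `P(y | s, do(π)) = P(y | s)` because `S` d-separates
`Y` from the node `X̂`, which may be seen as a switch between the natural mechanism of `X` and the
policy; `P(y | s)` is determined by `P(o, y)`.

No model with the switch is built: the equality `P(y, s) P(s | do(π)) = P(y, s | do(π)) P(s)`
(`SCM.marginal_joint_mul_marginal_jointDo`) is proved directly for the two mass functions. Both are
sums and integrals over products of the same factors, one for each variable `w`, except for the
factor of `X`. Let `H` be the graph with the arrows of the policy and with `X̂`.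

* Among the ancestors of `Y` and `S` in `H`, let `K` be the set of those `a` from which an open walk
  leads to `X̂` when `a` is entered through an arrowhead (`MixedGraph.Side`). As an open walk can be
  shortened to an open path (`Walk.OpenFrom.exists_isPath`), d-separation excludes open walks from
  `Y` to `X̂`. Hence `K` contains `X`, the factors in `K` do not involve `Y`, and they share with the
  other ancestral factors only variables in `S` and no exogenous ones (`mem_side_of_dir`,
  `not_fam_of_mem_side`, `mem_side_of_fam`, `mem_side_of_bi`).
* The non-ancestors are summed out (`IsMechanism.tsum_mul_massOf_univ`). The remaining sums and
  integrals split into a part for `K`, which does not depend on `y`, and a part for the other factors,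
  which is the same with and without the intervention (`IsMechanism.marginal_mul_marginal`).
-/

namespace CausalImitation

/-! ### Open walks and d-separation -/

namespace MixedGraph

variable {V : Type*} {G : MixedGraph V} {Z : Set V}

/-- The edge `e`, leaving `m`, cannot be used after entering `m`, where `h` says whether the edge
used for entering has an arrowhead at `m`. -/
def BlocksFrom (G : MixedGraph V) (Z : Set V) (h : Prop) {m b : V} (e : Step G m b) : Prop :=
  (h ∧ e.headAtStart ∧ ∀ d ∈ G.De m, d ∉ Z) ∨ (¬(h ∧ e.headAtStart) ∧ m ∈ Z)

/-- No node of the walk blocks, the last one excepted, when its first node is entered through an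
edge which has an arrowhead there iff `h` holds. -/
def Walk.OpenFrom (Z : Set V) : Prop → {a b : V} → Walk G a b → Prop
  | _, _, _, .nil _ => True
  | h, _, _, .cons e p => ¬ G.BlocksFrom Z h e ∧ p.OpenFrom Z e.headAtEnd

/-- The number of edges of a walk. -/
def Walk.length {a b : V} : Walk G a b → ℕ
  | .nil _ => 0
  | .cons _ p => p.length + 1

theorem Walk.OpenFrom.not_blocked {h : Prop} {a b : V} {p : Walk G a b} (hp : p.OpenFrom Z h) :
    ¬ p.Blocked Z := by
  induction p generalizing h with
  | nil a => simp [Walk.Blocked]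
  | cons e p ih =>
    cases p with
    | nil => simp [Walk.Blocked]
    | cons e' p =>
      rintro (hb | hb)
      · exact hp.2.1 hb
      · exact ih hp.2 hb

theorem mem_De_trans {a b c : V} (hab : b ∈ G.De a) (hbc : c ∈ G.De b) : c ∈ G.De a :=
  Relation.ReflTransGen.trans hab hbc

/-- A node `v` on an open walk from `c` is the start of an open final segment. If `v` has no
descendant in `Z`, is an ancestor of `c`, and `c` is entered through an arrowhead, then all edges up
to `v` point forward, so that `v` is entered through an arrowhead too. -/
theorem Walk.OpenFrom.exists_suffix {h : Prop} {c b v : V} {p : Walk G c b} (hp : p.OpenFrom Z h)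
    (hv : v ∈ p.support) :
    ∃ (h' : Prop) (q : Walk G v b), q.OpenFrom Z h' ∧ q.length ≤ p.length ∧
      q.support ⊆ p.support ∧
      (h → c ∈ G.De v → (∀ d ∈ G.De v, d ∉ Z) → h') := by
  induction p generalizing h with
  | nil a =>
    obtain rfl : v = a := by simpa [Walk.support] using hv
    exact ⟨h, .nil v, hp, le_rfl, List.Subset.refl _, fun hh _ _ => hh⟩
  | @cons c m b e p ih =>
    rcases List.mem_cons.1 hv with rfl | hv
    · exact ⟨h, .cons e p, hp, le_rfl, List.Subset.refl _, fun hh _ _ => hh⟩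
    · obtain ⟨h', q, hq, hl, hs, hh'⟩ := ih hp.2 hv
      refine ⟨h', q, hq, hl.trans (Nat.le_succ _), fun x hx => List.mem_cons_of_mem _ (hs hx), ?_⟩
      intro hh hc hZ
      have hnot : ¬ e.headAtStart := fun he =>
        hp.1 (Or.inl ⟨hh, he, fun d hd => hZ d (mem_De_trans hc hd)⟩)
      cases e with
      | fwd hd => exact hh' trivial (Relation.ReflTransGen.tail hc hd) hZ
      | bwd hd => exact absurd trivial hnot
      | bidir hd => exact absurd trivial hnot

/-- Loops of an open walk can be cut out: an open walk yields an open path. -/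
theorem Walk.OpenFrom.exists_isPath {h : Prop} {a b : V} {p : Walk G a b} (hp : p.OpenFrom Z h) :
    ∃ q : Walk G a b, q.IsPath ∧ q.OpenFrom Z h ∧ q.support ⊆ p.support := by
  induction hn : p.length using Nat.strong_induction_on generalizing h a with
  | _ n ih =>
    subst hn
    cases p with
    | nil => exact ⟨.nil _, by simp [Walk.IsPath, Walk.support], trivial, List.Subset.refl _⟩
    | @cons _ m _ e p =>
      by_cases ha : a ∈ p.support
      · obtain ⟨h', q, hq, hl, hs, hh'⟩ := hp.2.exists_suffix ha
        have hqo : q.OpenFrom Z h := by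
          cases q with
          | nil => trivial
          | cons e' q =>
            refine ⟨?_, hq.2⟩
            rintro (⟨hh, he', hZ⟩ | ⟨hnc, haZ⟩)
            · -- After the cut, `a` would be a collider without descendants in `Z`. Then `e` leaves
              -- `a` forward, and so the loop returns to `a` through an arrowhead.
              have hnot : ¬ e.headAtStart := fun he => hp.1 (Or.inl ⟨hh, he, hZ⟩)
              have : h' := by
                cases e with
                | fwd hd => exact hh' trivial (Relation.ReflTransGen.single hd) hZ
                | bwd hd => exact absurd trivial hnot
                | bidir hd => exact absurd trivial hnot
              exact hq.1 (Or.inl ⟨this, he', hZ⟩)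
            · have hh : h := by
                by_contra hh
                exact hp.1 (Or.inr ⟨fun hc => hh hc.1, haZ⟩)
              exact hq.1 (Or.inr ⟨fun hc => hnc ⟨hh, hc.2⟩, haZ⟩)
        obtain ⟨r, hr, hro, hrs⟩ := ih q.length (Nat.lt_succ_of_le hl) hqo rfl
        exact ⟨r, hr, hro, fun x hx => List.mem_cons_of_mem _ (hs (hrs hx))⟩
      · obtain ⟨q, hq, hqo, hqs⟩ := ih p.length (Nat.lt_succ_self _) hp.2 rfl
        refine ⟨.cons e q, List.nodup_cons.2 ⟨fun hx => ha (hqs hx), hq⟩, ⟨hp.1, hqo⟩, ?_⟩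
        exact List.cons_subset_cons _ hqs

/-- There is an open walk from `a` to `z` when `a` is entered through an edge which has an arrowhead
at `a` iff `h` holds. -/
def Opens (G : MixedGraph V) (Z : Set V) (z : V) (h : Prop) (a : V) : Prop :=
  ∃ p : Walk G a z, p.OpenFrom Z h

/-- The nodes with a descendant in `T`. -/
def An (G : MixedGraph V) (T : Set V) : Set V := {a | ∃ d ∈ G.De a, d ∈ T}

theorem subset_An (T : Set V) : T ⊆ G.An T := fun a ha => ⟨a, Relation.ReflTransGen.refl, ha⟩

theorem An_of_dir {T : Set V} {a b : V} (h : G.dir a b) (hb : b ∈ G.An T) : a ∈ G.An T := by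
  obtain ⟨d, hd, hT⟩ := hb
  exact ⟨d, Relation.ReflTransGen.head h hd, hT⟩

theorem DSep.not_opens {y z : V} (h : G.DSep {y} {z} Z) : ¬ G.Opens Z z False y := by
  rintro ⟨p, hp⟩
  obtain ⟨q, hq, hqo, -⟩ := hp.exists_isPath
  exact hqo.not_blocked (h y rfl z rfl q hq)

theorem Opens.cons {z a b : V} {h : Prop} (e : Step G a b) (he : ¬ G.BlocksFrom Z h e)
    (hb : G.Opens Z z e.headAtEnd b) : G.Opens Z z h a := by
  obtain ⟨p, hp⟩ := hb
  exact ⟨.cons e p, he, hp⟩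

theorem not_blocksFrom_false {a b : V} (e : Step G a b) (ha : a ∉ Z) : ¬ G.BlocksFrom Z False e := by
  rintro (⟨h, -⟩ | ⟨-, h⟩)
  · exact h
  · exact ha h

/-- An open walk into `z` from an ancestor `a` of `y` without descendants in `Z` is extended along
a directed path from `a` to `y`. -/
theorem Opens.of_mem_De {z a y : V} (hy : y ∈ G.De a) (ha : ∀ d ∈ G.De a, d ∉ Z)
    (h : G.Opens Z z False a) : G.Opens Z z False y := by
  induction hy with
  | refl => exact h
  | tail hab hbc ih =>
    exact Opens.cons (.bwd hbc) (not_blocksFrom_false _ (ha _ (hab.tail hbc))) ih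

/-- An open walk to `z` from an ancestor of `y` but not of `Z` would extend to an open walk from
`y`. -/
theorem mem_An_of_opens {z y a : V} (hsep : G.DSep {y} {z} Z) (ha : a ∈ G.An (insert y Z))
    (h : G.Opens Z z False a) : a ∈ G.An Z := by
  by_contra hZ
  have hZ' : ∀ d ∈ G.De a, d ∉ Z := fun d hd hdZ => hZ ⟨d, hd, hdZ⟩
  obtain ⟨d, hd, rfl | hdZ⟩ := ha
  · exact hsep.not_opens (h.of_mem_De hd hZ')
  · exact hZ' d hd hdZ

/-- The side of `z`: the ancestors `a` of `y` and `Z` from which an open walk leads to `z` if `a` is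
entered through an arrowhead. -/
def Side (G : MixedGraph V) (y z : V) (Z : Set V) : Set V :=
  {a | a ∈ G.An (insert y Z) ∧ G.Opens Z z True a}

theorem opens_false_of_opens_true {z a : V} (haz : a ≠ z) (ha : a ∉ Z) (h : G.Opens Z z True a) :
    G.Opens Z z False a := by
  obtain ⟨p, hp⟩ := h
  cases p with
  | nil => exact absurd rfl haz
  | cons e p => exact ⟨.cons e p, not_blocksFrom_false _ ha, hp.2⟩

theorem mem_side_of_opens_false {y z a : V} (hsep : G.DSep {y} {z} Z)
    (ha : a ∈ G.An (insert y Z)) (h : G.Opens Z z False a) : a ∈ G.Side y z Z := by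
  obtain ⟨d, hd, hdZ⟩ := mem_An_of_opens hsep ha h
  obtain ⟨p, hp⟩ := h
  refine ⟨ha, p, ?_⟩
  cases p with
  | nil => trivial
  | cons e p =>
    refine ⟨?_, hp.2⟩
    rintro (⟨-, -, hZ⟩ | ⟨-, haZ⟩)
    · exact hZ d hd hdZ
    · exact hp.1 (Or.inr ⟨fun hc => hc.1, haZ⟩)

/-- A node `a` at which the first edge of an open walk has an arrowhead is a collider after being
entered through an arrowhead, so it must be an ancestor of `Z`. Otherwise `a` is an ancestor of `y`,
which is excluded by d-separation. -/
theorem mem_side_of_head {y z a b : V} (hsep : G.DSep {y} {z} Z)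
    (ha : a ∈ G.An (insert y Z)) (e : Step G a b) (he : e.headAtStart)
    (h : G.Opens Z z e.headAtEnd b) : a ∈ G.Side y z Z := by
  by_cases haZ : a ∈ G.An Z
  · obtain ⟨d, hd, hdZ⟩ := haZ
    refine ⟨ha, h.cons e ?_⟩
    rintro (⟨-, -, hZ⟩ | ⟨hc, -⟩)
    · exact hZ d hd hdZ
    · exact hc ⟨trivial, he⟩
  · have h' : G.Opens Z z False a :=
      h.cons e (not_blocksFrom_false _ fun hZ => haZ (subset_An _ hZ))
    exact mem_side_of_opens_false hsep ha h'

/-- The node `v` is `w` or a parent of `w`: it is one of the endogenous variables in the factor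
`P(w | pa_w, u_w)` of `w`. -/
def Fam (G : MixedGraph V) (w v : V) : Prop := v = w ∨ G.dir v w

theorem opens_false_of_fam {y z w v : V} (hw : w ∈ G.Side y z Z) (hwz : w ≠ z)
    (hvw : G.Fam w v) (hv : v ∉ Z) : G.Opens Z z False v := by
  rcases hvw with rfl | hvw
  · exact opens_false_of_opens_true hwz hv hw.2
  · exact hw.2.cons (.fwd hvw) (not_blocksFrom_false _ hv)

theorem not_fam_of_mem_side {y z w : V} (hsep : G.DSep {y} {z} Z) (hy : y ∉ Z)
    (hw : w ∈ G.Side y z Z) (hwz : w ≠ z) : ¬ G.Fam w y := fun h =>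
  hsep.not_opens (opens_false_of_fam hw hwz h hy)

/-- Factors which share a variable outside `Z` lie on the same side. -/
theorem mem_side_of_fam {y z w w' v : V} (hsep : G.DSep {y} {z} Z)
    (hw : w ∈ G.Side y z Z) (hwz : w ≠ z) (hvw : G.Fam w v) (hv : v ∉ Z) (hvw' : G.Fam w' v)
    (hw' : w' ∈ G.An (insert y Z)) : w' ∈ G.Side y z Z := by
  have ho := opens_false_of_fam hw hwz hvw hv
  rcases hvw' with rfl | hvw'
  · exact mem_side_of_opens_false hsep hw' ho
  · exact mem_side_of_head hsep hw' (.bwd hvw') trivial ho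

/-- Factors joined by a bi-directed arrow lie on the same side. -/
theorem mem_side_of_bi {y z w w' : V} (hsep : G.DSep {y} {z} Z)
    (hw : w ∈ G.Side y z Z) (h : G.bi.Adj w' w)
    (hw' : w' ∈ G.An (insert y Z)) : w' ∈ G.Side y z Z :=
  mem_side_of_head hsep hw' (.bidir h) trivial hw.2

theorem mem_side_of_dir {y z w : V} (hsep : G.DSep {y} {z} Z) (h : G.dir z w)
    (hw : w ∈ G.An (insert y Z)) : w ∈ G.Side y z Z :=
  mem_side_of_head hsep hw (.bwd h) trivial ⟨.nil z, trivial⟩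

end MixedGraph

/-! ### Sums and integrals over products -/

section Product

variable {V : Type*} {D : V → Type*}

open Classical in
theorem tsum_pi_eq_tsum_update [DecidableEq V] (F : (∀ w, D w) → ℝ≥0∞) (w : V) (c : D w) :
    ∑' x, F x = ∑' x : ∀ w, D w, if x w = c then ∑' a, F (Function.update x w a) else 0 := by
  rw [← (Equiv.piSplitAt w D).symm.tsum_eq F,
    ← (Equiv.piSplitAt w D).symm.tsum_eq (fun x : ∀ w, D w =>
      if x w = c then ∑' a, F (Function.update x w a) else 0)]
  rw [ENNReal.tsum_prod', ENNReal.tsum_prod', ENNReal.tsum_comm,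
    ENNReal.tsum_comm (α := D w)]
  refine tsum_congr fun r => ?_
  have hw : ∀ b, (Equiv.piSplitAt w D).symm (b, r) w = b := fun b => by simp [Equiv.piSplitAt]
  simp only [hw]
  rw [tsum_ite_eq]
  refine tsum_congr fun a => congrArg F ?_
  funext j
  by_cases h : j = w
  · subst h; simp
  · simp [Equiv.piSplitAt, h]

/-- A sum over configurations of a product of two functions of complementary sets of variables is
the product of a quantity determined by the first function and one determined by the second. -/
theorem exists_tsum_mul_eq (J : Set V) :
    ∃ α β : ((∀ w, D w) → ℝ≥0∞) → ℝ≥0∞, ∀ f h : (∀ w, D w) → ℝ≥0∞, DependsOn f J →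
      DependsOn h Jᶜ → ∑' x, f x * h x = α f * β h := by
  classical
  rcases isEmpty_or_nonempty (∀ w, D w) with hE | ⟨⟨x₀⟩⟩
  · exact ⟨0, 0, fun f h _ _ => by simp⟩
  let e := Equiv.piEquivPiSubtypeProd (· ∈ J) D
  refine ⟨fun f => ∑' p, f (e.symm (p, (e x₀).2)), fun h => ∑' q, h (e.symm ((e x₀).1, q)),
    fun f h hf hh => ?_⟩
  rw [← e.symm.tsum_eq, ENNReal.tsum_prod', ← ENNReal.tsum_mul_right]
  refine tsum_congr fun p => ?_
  rw [← ENNReal.tsum_mul_left]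
  refine tsum_congr fun q => ?_
  congr 1
  · exact hf fun i hi => by simp [e, Equiv.piEquivPiSubtypeProd, hi]
  · exact hh fun i hi => by
      have hi : i ∉ J := hi
      simp [e, Equiv.piEquivPiSubtypeProd, hi]

open MeasureTheory in
/-- Functions of disjoint sets of independent variables are independent. -/
theorem lintegral_pi_mul_of_dependsOn {U : Type*} [Fintype U] {E : U → Type*}
    [∀ j, MeasurableSpace (E j)] (P : ∀ j, Measure (E j)) [∀ j, IsProbabilityMeasure (P j)]
    {f h : (∀ j, E j) → ℝ≥0∞} (hf : Measurable f) (hh : Measurable h) {I : Set U}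
    (hfI : DependsOn f I) (hhI : DependsOn h Iᶜ) :
    ∫⁻ u, f u * h u ∂Measure.pi P = (∫⁻ u, f u ∂Measure.pi P) * ∫⁻ u, h u ∂Measure.pi P := by
  classical
  obtain ⟨u₀⟩ : Nonempty (∀ j, E j) := ⟨fun j => (nonempty_of_isProbabilityMeasure (P j)).some⟩
  let e := MeasurableEquiv.piEquivPiSubtypeProd E (· ∈ I)
  have key : ∀ f h : (∀ j, E j) → ℝ≥0∞, Measurable f → Measurable h → DependsOn f I →
      DependsOn h Iᶜ → ∫⁻ u, f u * h u ∂Measure.pi P =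
        (∫⁻ p, f (e.symm (p, (e u₀).2)) ∂Measure.pi fun i : {i // i ∈ I} => P i) *
          ∫⁻ q, h (e.symm ((e u₀).1, q)) ∂Measure.pi fun i : {i // i ∉ I} => P i := by
    intro f h hf hh hfI hhI
    have hmp := measurePreserving_piEquivPiSubtypeProd P (· ∈ I)
    have hf' : Measurable fun p => f (e.symm (p, (e u₀).2)) := by fun_prop
    have hh' : Measurable fun q => h (e.symm ((e u₀).1, q)) := by fun_prop
    rw [← lintegral_prod_mul hf'.aemeasurable hh'.aemeasurable,
      ← hmp.lintegral_comp_emb (MeasurableEquiv.measurableEmbedding _)]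
    refine lintegral_congr fun u => ?_
    congr 1
    · exact hfI fun i hi => by
        simp [e, MeasurableEquiv.piEquivPiSubtypeProd, Equiv.piEquivPiSubtypeProd, hi]
    · exact hhI fun i hi => by
        have hi : i ∉ I := hi
        simp [e, MeasurableEquiv.piEquivPiSubtypeProd, Equiv.piEquivPiSubtypeProd, hi]
  have h1 : ∀ s : Set U, DependsOn (fun _ : ∀ j, E j => (1 : ℝ≥0∞)) s := fun s _ _ _ => rfl
  have ef := key f (fun _ => 1) hf measurable_const hfI (h1 _)
  have eh := key (fun _ => 1) h measurable_const hh (h1 _) hhI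
  simp only [mul_one, one_mul, lintegral_const, measure_univ] at ef eh
  rw [key f h hf hh hfI hhI, ef, eh]

theorem dependsOn_prod {ι : Type*} {s : Finset ι} {f : ι → (∀ w, D w) → ℝ≥0∞} {J : Set V}
    (h : ∀ i ∈ s, DependsOn (f i) J) : DependsOn (fun x => ∏ i ∈ s, f i x) J :=
  fun _ _ hxy => Finset.prod_congr rfl fun i hi => h i hi hxy

end Product

/-! ### Families of mechanisms -/

theorem exists_source {V : Type*} [Finite V] {Q : V → Set V}
    (hQ : ∀ a, ¬ Relation.TransGen (fun b c => b ∈ Q c) a a)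
    {N : Finset V} (hN : N.Nonempty) : ∃ w ∈ N, ∀ v ∈ N, v ∉ Q w := by
  let r : V → V → Prop := Relation.TransGen (fun b c => b ∈ Q c)
  have : Std.Irrefl r := ⟨hQ⟩
  have : IsTrans V r := ⟨fun _ _ _ => Relation.TransGen.trans⟩
  obtain ⟨w, hw, hmin⟩ := (Finite.wellFounded_of_trans_of_irrefl r).has_min (N : Set V) hN
  exact ⟨w, hw, fun v hv hvw => hmin v hv (.single hvw)⟩

section Mechanisms

open MeasureTheory

variable {V : Type*} [DecidableEq V] {D : V → Type*} {U : Type*} {E : U → Type*}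
  [∀ j, MeasurableSpace (E j)]

/-- A family of conditional mass functions `g w x u` of `x w`, given the values of `x` on the parents
`Q w` and of `u` on the exogenous arguments `ex w`. It covers structural functions, whose mass
functions are indicators, as well as policies. -/
structure IsMechanism (Q : V → Set V) (ex : V → Set U)
    (g : V → (∀ w, D w) → (∀ j, E j) → ℝ≥0∞) : Prop where
  measurable : ∀ w x, Measurable (g w x)
  dependsOn : ∀ w u, DependsOn (fun x => g w x u) (insert w (Q w))
  dependsOn_exo : ∀ w x, DependsOn (g w x) (ex w)
  tsum_eq_one : ∀ w x u, ∑' a, g w (Function.update x w a) u = 1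

variable {Q : V → Set V} {ex : V → Set U} {g : V → (∀ w, D w) → (∀ j, E j) → ℝ≥0∞}

open Classical in
/-- Mechanisms of variables on which the other factors do not depend sum to one. To keep a sum over
all configurations after the variables in `N` are summed out, their values are pinned to those of a
fixed configuration `x₀`. -/
theorem IsMechanism.tsum_mul_prod [Finite V] (hg : IsMechanism Q ex g)
    (hQ : ∀ a, ¬ Relation.TransGen (fun b c => b ∈ Q c) a a) (x₀ : ∀ w, D w) (u : ∀ j, E j)
    (N : Finset V) {φ : (∀ w, D w) → ℝ≥0∞} (hφ : DependsOn φ (N : Set V)ᶜ) :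
    ∑' x, φ x * ∏ w ∈ N, g w x u = ∑' x, if ∀ w ∈ N, x w = x₀ w then φ x else 0 := by
  induction hn : N.card generalizing N φ with
  | zero => simp [Finset.card_eq_zero.1 hn]
  | succ n ih =>
    -- After a source `w` of `N` is removed, the mechanism of `w` does not involve the remaining
    -- variables of `N` and can be treated as part of `φ`.
    obtain ⟨w, hw, hmin⟩ := exists_source hQ (Finset.card_pos.1 (by omega : 0 < N.card))
    have hφ' : DependsOn (fun x => φ x * g w x u) (↑(N.erase w) : Set V)ᶜ := by
      intro x y hxy
      refine congrArg₂ (· * ·) (hφ fun i hi => hxy i fun h => hi (Finset.mem_of_mem_erase h))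
        (hg.dependsOn w u fun i hi => hxy i fun h => ?_)
      rcases hi with rfl | hi
      · exact Finset.notMem_erase _ _ h
      · exact hmin i (Finset.mem_of_mem_erase h) hi
    have h1 : ∑' x, φ x * ∏ w ∈ N, g w x u = ∑' x, φ x * g w x u * ∏ w ∈ N.erase w, g w x u :=
      tsum_congr fun x => by rw [mul_assoc, Finset.mul_prod_erase _ (fun w => g w x u) hw]
    rw [h1, ih (N.erase w) hφ' (by rw [Finset.card_erase_of_mem hw, hn]; rfl),
      tsum_pi_eq_tsum_update _ w (x₀ w)]
    refine tsum_congr fun x => ?_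
    have hup : ∀ a, (∀ v ∈ N.erase w, Function.update x w a v = x₀ v) ↔
        ∀ v ∈ N.erase w, x v = x₀ v := fun a => forall₂_congr fun v hv => by
      rw [Function.update_of_ne (Finset.ne_of_mem_erase hv)]
    have hφw : ∀ a, φ (Function.update x w a) = φ x := fun a => hφ fun i hi => by
      rw [Function.update_of_ne]
      rintro rfl
      exact hi hw
    simp only [hup, hφw]
    by_cases hx : ∀ v ∈ N.erase w, x v = x₀ v
    · have hN : (∀ v ∈ N, x v = x₀ v) ↔ x w = x₀ w := by
        refine ⟨fun h => h w hw, fun h v hv => ?_⟩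
        by_cases hvw : v = w
        · exact hvw ▸ h
        · exact hx v (Finset.mem_erase.2 ⟨hvw, hv⟩)
      simp only [if_pos hx, hN, ENNReal.tsum_mul_left, hg.tsum_eq_one, mul_one]
    · have hN : ¬ ∀ v ∈ N, x v = x₀ v := fun h => hx fun v hv => h v (Finset.mem_of_mem_erase hv)
      simp only [if_neg hx, if_neg hN, tsum_zero, ite_self]

theorem IsMechanism.measurable_prod (hg : IsMechanism Q ex g) (s : Finset V) (x : ∀ w, D w) :
    Measurable fun u => ∏ w ∈ s, g w x u :=
  Finset.measurable_fun_prod _ fun w _ => hg.measurable w x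

variable [Fintype U] (P : ∀ j, Measure (E j))

/-- The integral of the product of the mechanisms of the variables in `s`, as a function of the
configuration `x`. -/
noncomputable def massOf (g : V → (∀ w, D w) → (∀ j, E j) → ℝ≥0∞) (s : Finset V)
    (x : ∀ w, D w) : ℝ≥0∞ :=
  ∫⁻ u, ∏ w ∈ s, g w x u ∂Measure.pi P

theorem IsMechanism.dependsOn_massOf (hg : IsMechanism Q ex g) {s : Finset V} {J : Set V}
    (hJ : ∀ w ∈ s, insert w (Q w) ⊆ J) : DependsOn (massOf P g s) J := fun _ _ hxy =>
  lintegral_congr fun u => Finset.prod_congr rfl fun w hw =>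
    hg.dependsOn w u fun i hi => hxy i (hJ w hw hi)

/-- The exogenous variables of two groups of mechanisms without common exogenous arguments are
integrated separately. -/
theorem IsMechanism.massOf_union [∀ j, IsProbabilityMeasure (P j)] (hg : IsMechanism Q ex g)
    {K B : Finset V} (hKB : Disjoint K B)
    (hex : ∀ w ∈ K, ∀ w' ∈ B, Disjoint (ex w) (ex w')) (x : ∀ w, D w) :
    massOf P g (K ∪ B) x = massOf P g K x * massOf P g B x := by
  simp only [massOf, Finset.prod_union hKB]
  refine lintegral_pi_mul_of_dependsOn P (hg.measurable_prod K x) (hg.measurable_prod B x)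
    (I := ⋃ w ∈ K, ex w) ?_ ?_
  · exact dependsOn_prod fun w hw => (hg.dependsOn_exo w x).mono (Set.subset_biUnion_of_mem hw)
  · refine dependsOn_prod fun w' hw' => (hg.dependsOn_exo w' x).mono fun j hj hjK => ?_
    obtain ⟨w, hw, hjw⟩ := Set.mem_iUnion₂.1 hjK
    exact Set.disjoint_left.1 (hex w hw w' hw') hjw hj

variable [Fintype V] [∀ j, IsProbabilityMeasure (P j)]

open Classical in
/-- The variables of a set `N` without children outside `N` can be summed out: their mechanisms
disappear, and their values are pinned to those of a configuration `x₀`. -/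
theorem IsMechanism.tsum_mul_massOf_univ [∀ w, Countable (D w)] (hg : IsMechanism Q ex g)
    (hQ : ∀ a, ¬ Relation.TransGen (fun b c => b ∈ Q c) a a) (x₀ : ∀ w, D w)
    {N : Finset V} (hN : ∀ w ∉ N, insert w (Q w) ⊆ (N : Set V)ᶜ) {c : (∀ w, D w) → ℝ≥0∞}
    (hc : DependsOn c (N : Set V)ᶜ) (hfin : ∀ x, c x ≠ ∞) :
    ∑' x, c x * massOf P g Finset.univ x =
      ∑' x, if ∀ w ∈ N, x w = x₀ w then c x * massOf P g Nᶜ x else 0 := by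
  have h1 : ∀ x, c x * massOf P g Finset.univ x =
      ∫⁻ u, c x * (∏ w ∈ Nᶜ, g w x u) * ∏ w ∈ N, g w x u ∂Measure.pi P := fun x => by
    rw [massOf, ← lintegral_const_mul' _ _ (hfin x)]
    exact lintegral_congr fun u => by rw [mul_assoc, Finset.prod_compl_mul_prod]
  have h2 : ∀ x, (if ∀ w ∈ N, x w = x₀ w then c x * massOf P g Nᶜ x else 0) =
      ∫⁻ u, (if ∀ w ∈ N, x w = x₀ w then c x * (∏ w ∈ Nᶜ, g w x u) else 0) ∂Measure.pi P :=
    fun x => by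
      split_ifs
      · rw [massOf, ← lintegral_const_mul' _ _ (hfin x)]
      · simp
  simp only [h1, h2]
  rw [← lintegral_tsum, ← lintegral_tsum]
  · refine lintegral_congr fun u => (hg.tsum_mul_prod hQ x₀ u N ?_).trans
      (tsum_congr fun x => by congr)
    exact fun x y hxy => congrArg₂ (· * ·) (hc hxy) (Finset.prod_congr rfl fun w hw =>
      hg.dependsOn w u fun i hi => hxy i (hN w (Finset.mem_compl.1 hw) hi))
  · intro x
    split_ifs
    · exact ((hg.measurable_prod _ x).const_mul _).aemeasurable
    · exact aemeasurable_const
  · exact fun x => (((hg.measurable_prod _ x).const_mul _).mul (hg.measurable_prod _ x)).aemeasurable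

theorem IsMechanism.tsum_massOf_univ [∀ w, Countable (D w)] (hg : IsMechanism Q ex g)
    (hQ : ∀ a, ¬ Relation.TransGen (fun b c => b ∈ Q c) a a) (x₀ : ∀ w, D w) :
    ∑' x, massOf P g Finset.univ x = 1 := by
  classical
  have h := hg.tsum_mul_massOf_univ P hQ x₀ (N := Finset.univ) (c := fun _ => 1) (by simp)
    (fun _ _ _ => rfl) (by simp)
  have h3 : ∀ x : ∀ w, D w, (∀ w, x w = x₀ w) ↔ x = x₀ := fun x => funext_iff.symm
  simpa [massOf, h3, tsum_ite_eq] using h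

/-- Let `g` and `g'` be two systems of mechanisms which agree outside `K`. If the mechanisms in `K`
share with the remaining ones (those of the variables in `N`, which can be summed out, excepted) no
exogenous variables and only endogenous variables in `S`, and if those in `K` involve no variables
of `T` outside `S`, then `g` and `g'` define the same conditional distribution of `T` given `S`:
both marginals over `T` are the product of a factor which depends on the values on `S` only and a
common one. -/
theorem IsMechanism.marginal_mul_marginal [∀ w, Countable (D w)]
    {g' : V → (∀ w, D w) → (∀ j, E j) → ℝ≥0∞}
    (hg : IsMechanism Q ex g) (hg' : IsMechanism Q ex g')
    (hQ : ∀ a, ¬ Relation.TransGen (fun b c => b ∈ Q c) a a)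
    {K N : Finset V} {S T : Set V} (hgg' : ∀ w ∉ K, g w = g' w)
    (hN : ∀ w ∉ N, insert w (Q w) ⊆ (N : Set V)ᶜ) (hST : S ⊆ T) (hTN : ∀ w ∈ T, w ∉ N)
    (hKN : Disjoint K N) (hKT : ∀ w ∈ K, ∀ v ∈ insert w (Q w), v ∈ T → v ∈ S)
    (hK : ∀ w ∈ K, ∀ w' ∈ (K ∪ N)ᶜ, ∀ v ∈ insert w (Q w), v ∈ insert w' (Q w') → v ∈ S)
    (hex : ∀ w ∈ K, ∀ w' ∈ (K ∪ N)ᶜ, Disjoint (ex w) (ex w'))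
    (t t' : ∀ w : T, D w) (htt' : ∀ w (hw : w ∈ S), t ⟨w, hST hw⟩ = t' ⟨w, hST hw⟩) :
    marginal (massOf P g Finset.univ) T t * marginal (massOf P g' Finset.univ) T t' =
      marginal (massOf P g' Finset.univ) T t * marginal (massOf P g Finset.univ) T t' := by
  classical
  rcases isEmpty_or_nonempty (∀ w, D w) with hE | ⟨⟨x₀⟩⟩
  · simp [marginal]
  -- The first set of coordinates are the variables outside `S` of the mechanisms in `K`.
  obtain ⟨α, β, hαβ⟩ := exists_tsum_mul_eq (D := D) {v | v ∉ S ∧ ∃ w ∈ K, v ∈ insert w (Q w)}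
  -- With the values on `S` overwritten by `t`, the part for `K` depends on these coordinates only.
  let ov : (∀ w : T, D w) → (∀ w, D w) → ∀ w, D w := fun t x w =>
    if h : w ∈ S then t ⟨w, hST h⟩ else x w
  have hov : ov t = ov t' := by
    funext x w
    by_cases h : w ∈ S
    · simp [ov, h, htt' w h]
    · simp [ov, h]
  let b (g : V → (∀ w, D w) → (∀ j, E j) → ℝ≥0∞) (t : ∀ w : T, D w) (x : ∀ w, D w) : ℝ≥0∞ :=
    if ∀ w ∈ N, x w = x₀ w then
      if ∀ w : T, x w = t w then massOf P g (K ∪ N)ᶜ x else 0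
    else 0
  have hb : b g = b g' := by
    have : massOf P g (K ∪ N)ᶜ = massOf P g' (K ∪ N)ᶜ := funext fun x => lintegral_congr fun u =>
      Finset.prod_congr rfl fun w hw => by
        rw [hgg' w fun h => Finset.mem_compl.1 hw (Finset.mem_union_left _ h)]
    funext t x
    simp only [b, this]
  have hNc : Nᶜ = K ∪ (K ∪ N)ᶜ := by
    ext w
    have : w ∈ K → w ∉ N := fun h => Finset.disjoint_left.1 hKN h
    simp only [Finset.mem_compl, Finset.mem_union]
    tauto
  have hdisj : Disjoint K (K ∪ N)ᶜ :=
    Finset.disjoint_left.2 fun w hw h => Finset.mem_compl.1 h (Finset.mem_union_left _ hw)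
  have key : ∀ g, IsMechanism Q ex g → ∀ t, marginal (massOf P g Finset.univ) T t =
      α (fun x => massOf P g K (ov t x)) * β (b g t) := by
    intro g hg t
    have h1 := hg.tsum_mul_massOf_univ P hQ x₀ hN
      (c := fun x => if ∀ w : T, x w = t w then 1 else 0)
      (fun x y hxy => by
        have : ∀ w : T, x w = y w := fun w => hxy w (hTN w w.2)
        simp only [this]) (fun x => by split_ifs <;> simp)
    simp only [ite_mul, one_mul, zero_mul] at h1
    have h0 : marginal (massOf P g Finset.univ) T t = _ :=
      (tsum_congr fun x => by congr).trans h1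
    rw [h0, ← hαβ]
    · refine tsum_congr fun x => ?_
      simp only [b, mul_ite, mul_zero]
      refine if_congr Iff.rfl (if_ctx_congr Iff.rfl (fun hx => ?_) fun _ => rfl) rfl
      have : ov t x = x := by
        funext w
        by_cases h : w ∈ S
        · simp [ov, h, ← hx ⟨w, hST h⟩]
        · simp [ov, h]
      rw [this, hNc, hg.massOf_union P hdisj hex]
    · intro x y hxy
      refine hg.dependsOn_massOf P (J := {v | ∃ w ∈ K, v ∈ insert w (Q w)})
        (fun w hw v hv => ⟨w, hw, hv⟩) fun v hv => ?_
      by_cases h : v ∈ S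
      · simp [ov, h]
      · simpa [ov, h] using hxy v ⟨h, hv⟩
    · intro x y hxy
      have hN' : ∀ w ∈ N, x w = y w := fun w hw => hxy w fun ⟨_, w', hw', hww'⟩ =>
        hN w' (Finset.disjoint_left.1 hKN hw') hww' hw
      have hT' : ∀ w : T, x w = y w := fun w => hxy w fun ⟨h, w', hw', hww'⟩ =>
        h (hKT w' hw' w hww' w.2)
      have hm : massOf P g (K ∪ N)ᶜ x = massOf P g (K ∪ N)ᶜ y :=
        hg.dependsOn_massOf P (J := {v | v ∉ S ∧ ∃ w ∈ K, v ∈ insert w (Q w)}ᶜ)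
          (fun w' hw' v hv ⟨hvS, w, hw, hvw⟩ => hvS (hK w hw w' hw' v hvw hv)) hxy
      have hNi : (∀ w ∈ N, x w = x₀ w) ↔ ∀ w ∈ N, y w = x₀ w :=
        forall₂_congr fun w hw => by rw [hN' w hw]
      simp only [b, hNi, hT', hm]
  rw [key g hg, key g' hg', key g' hg', key g hg, hov, hb]
  ring

end Mechanisms

/-! ### Marginals -/

section Marginal

variable {V : Type*} {D : V → Type*}

open Classical in
theorem marginal_eq_tsum_marginal (p : (∀ w, D w) → ℝ≥0∞) {S T : Set V} (hST : S ⊆ T)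
    (s : ∀ w : S, D w) :
    marginal p S s = ∑' t : ∀ w : T, D w,
      if ∀ w : S, t ⟨w, hST w.2⟩ = s w then marginal p T t else 0 := by
  have h1 : ∀ t : ∀ w : T, D w,
      (if ∀ w : S, t ⟨w, hST w.2⟩ = s w then marginal p T t else 0) =
      ∑' x : ∀ w, D w, if t = (fun w : T => x w) then
        (if ∀ w : S, x w = s w then p x else 0) else 0 := by
    intro t
    by_cases ht : ∀ w : S, t ⟨w, hST w.2⟩ = s w
    · rw [if_pos ht, marginal]
      refine tsum_congr fun x => ?_
      by_cases hx : ∀ w : T, x w = t w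
      · have hs : ∀ w : S, x w = s w := fun w => (hx ⟨w, hST w.2⟩).trans (ht w)
        rw [if_pos hx, if_pos (funext fun w => (hx w).symm), if_pos hs]
      · rw [if_neg hx, if_neg fun h => hx fun w => (congrFun h w).symm]
    · rw [if_neg ht]
      refine (ENNReal.tsum_eq_zero.2 fun x => ?_).symm
      split_ifs with hx hs
      · exact absurd (fun w : S => (congrFun hx ⟨w, hST w.2⟩).trans (hs w)) ht
      all_goals rfl
  simp only [h1]
  rw [ENNReal.tsum_comm]
  exact tsum_congr fun x => (tsum_ite_eq (fun w : T => x w) fun _ => _).symm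

theorem marginal_eq_of_subset {p q : (∀ w, D w) → ℝ≥0∞} {S T : Set V} (hST : S ⊆ T)
    (h : marginal p T = marginal q T) : marginal p S = marginal q S := by
  funext s
  rw [marginal_eq_tsum_marginal p hST, marginal_eq_tsum_marginal q hST, h]

theorem marginal_pos_of_subset [Nonempty (∀ w, D w)] {p : (∀ w, D w) → ℝ≥0∞} {S T : Set V}
    (hST : S ⊆ T) (h : ∀ t, 0 < marginal p T t) (s : ∀ w : S, D w) : 0 < marginal p S s := by
  classical
  obtain ⟨x₀⟩ := ‹Nonempty (∀ w, D w)›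
  let t : ∀ w : T, D w := fun w => if hw : (w : V) ∈ S then s ⟨w, hw⟩ else x₀ w
  have ht : ∀ w : S, t ⟨w, hST w.2⟩ = s w := fun w => by simp [t]
  rw [marginal_eq_tsum_marginal p hST]
  refine (h t).trans_le (le_trans ?_ (ENNReal.le_tsum t))
  rw [if_pos ht]

theorem marginal_le_tsum (p : (∀ w, D w) → ℝ≥0∞) (S : Set V) (s : ∀ w : S, D w) :
    marginal p S s ≤ ∑' x, p x :=
  ENNReal.tsum_le_tsum fun x => by split_ifs <;> simp

end Marginal

/-! ### Models -/

section Models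

variable {V : Type*} {D : V → Type*}

namespace CausalDiagram

/-- The parents of `w` in the diagram `G ∪ Π`. -/
def policyPa (G : CausalDiagram V) (X : V) (C : Set V) (w : V) : Set V :=
  {v | G.dir v w ∨ (v ∈ C ∧ w = X)}

theorem De_removeIncoming {G : CausalDiagram V} {X d : V} (h : d ∈ G.De X) :
    d ∈ (G.toMixedGraph.removeIncoming X).De X := by
  induction h with
  | refl => exact Relation.ReflTransGen.refl
  | tail hXb hbc ih =>
    refine ih.tail ⟨hbc, ?_⟩
    rintro rfl
    exact G.acyclic _ (Relation.TransGen.tail' hXb hbc)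

theorem IsPolicySpace.mono {G : CausalDiagram V} {X : V} {C C' : Set V} (hC : G.IsPolicySpace X C)
    (h : C' ⊆ C) : G.IsPolicySpace X C' := h.trans hC

theorem IsPolicySpace.notMem_De {G : CausalDiagram V} {X : V} {C : Set V}
    (hC : G.IsPolicySpace X C) {c : V} (hc : c ∈ C) : c ∉ G.De X := fun h =>
  (hC hc).2 (De_removeIncoming h)

/-- No cycle of `G ∪ Π` uses an arrow from a covariate to `X`, as no covariate is a descendant of
`X`. -/
theorem IsPolicySpace.acyclic {G : CausalDiagram V} {X : V} {C : Set V}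
    (hC : G.IsPolicySpace X C) (a : V) :
    ¬ Relation.TransGen (fun b c => b ∈ G.policyPa X C c) a a := by
  have key : ∀ b, Relation.TransGen (fun b c => b ∈ G.policyPa X C c) a b →
      Relation.TransGen G.dir a b ∨ ∃ c ∈ C, c ∈ G.De a ∧ b ∈ G.De X := by
    intro b hb
    induction hb with
    | single h =>
      rcases h with h | ⟨h, rfl⟩
      · exact Or.inl (.single h)
      · exact Or.inr ⟨a, h, Relation.ReflTransGen.refl, Relation.ReflTransGen.refl⟩
    | tail hab hbc ih =>
      rcases ih with ih | ⟨c, hc, hac, hX⟩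
      · rcases hbc with h | ⟨h, rfl⟩
        · exact Or.inl (ih.tail h)
        · exact Or.inr ⟨_, h, ih.to_reflTransGen, Relation.ReflTransGen.refl⟩
      · rcases hbc with h | ⟨h, rfl⟩
        · exact Or.inr ⟨c, hc, hac, Relation.ReflTransGen.tail hX h⟩
        · exact absurd hX (hC.notMem_De h)
  intro h
  rcases key a h with h | ⟨c, hc, hac, hX⟩
  · exact G.acyclic a h
  · exact hC.notMem_De hc (Relation.ReflTransGen.trans hX hac)

theorem fam_withPolicy {G : CausalDiagram V} {X : V} {C : Set V} {v w : V}
    (h : v ∈ insert w (G.policyPa X C w)) : (G.withPolicy X C).Fam (some w) (some v) := by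
  rcases h with rfl | h
  · exact Or.inl rfl
  · exact Or.inr h

end CausalDiagram

namespace SCM

/-- The mechanisms after the intervention `do(π)`: that of `X` is the policy. -/
noncomputable def mechDo [DecidableEq V] (M : SCM D) (X : V) {C : Set V} (π : Policy D X C) (w : V)
    (x : ∀ w, D w) (u : ∀ j, M.E j) : ℝ≥0∞ :=
  if w = X then π (fun a => x a) (x X) else M.mech x u w

theorem measurable_mech (M : SCM D) (w : V) (x : ∀ w, D w) :
    Measurable fun u => M.mech x u w := by
  have h : Measurable fun (u : ∀ j, M.E j) (j : M.ex w) => u j :=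
    measurable_pi_lambda _ fun j => measurable_pi_apply _
  exact Measurable.ite (h (M.measurable_f w (fun a => x a) (x w))) measurable_const measurable_const

open Classical in
theorem tsum_mech_update [DecidableEq V] (M : SCM D) (w : V) (x : ∀ w, D w) (u : ∀ j, M.E j) :
    ∑' a, M.mech (Function.update x w a) u w = 1 := by
  have h : ∀ a, (fun v : M.pa w => Function.update x w a v) = fun v : M.pa w => x v := fun a =>
    funext fun v => Function.update_of_ne (fun hv => M.acyclic w (.single (by
      have := v.2
      rwa [hv] at this))) _ _
  have hm : ∀ a, M.mech (Function.update x w a) u w =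
      if M.f w (fun v => x v) (fun j => u j) = a then 1 else 0 := fun a => by
    have hf := congrArg (fun b => M.f w b fun j => u j) (h a)
    exact if_congr (by rw [hf, Function.update_self]) rfl rfl
  simp only [hm]
  exact tsum_ite_eq' (M.f w (fun v => x v) fun j => u j) fun _ => 1

open Classical in
theorem dependsOn_mech (M : SCM D) (w : V) (u : ∀ j, M.E j) :
    DependsOn (fun x => M.mech x u w) (insert w (M.pa w)) := by
  intro x y hxy
  have h : (fun v : M.pa w => x v) = fun v : M.pa w => y v :=
    funext fun v => hxy v (Set.mem_insert_of_mem _ v.2)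
  have hf : (M.f w (fun a => x a) fun j => u j) = M.f w (fun a => y a) fun j => u j :=
    congrArg (fun a => M.f w a fun j => u j) h
  exact if_congr (by rw [hf, hxy w (Set.mem_insert _ _)]) rfl rfl

open Classical in
theorem dependsOn_exo_mech (M : SCM D) (w : V) (x : ∀ w, D w) :
    DependsOn (fun u => M.mech x u w) (M.ex w) := by
  intro u u' huu'
  have h : (fun j : M.ex w => u j) = fun j : M.ex w => u' j := funext fun j => huu' j j.2
  have hf : (M.f w (fun a => x a) fun j => u j) = M.f w (fun a => x a) fun j => u' j :=
    congrArg (M.f w fun a => x a) h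
  exact if_congr (by rw [hf]) rfl rfl

theorem isMechanism_mech [DecidableEq V] (M : SCM D) {Q : V → Set V}
    (hQ : ∀ w, M.pa w ⊆ Q w) : IsMechanism Q M.ex fun w x u => M.mech x u w where
  measurable := M.measurable_mech
  dependsOn w u := (M.dependsOn_mech w u).mono (Set.insert_subset_insert (hQ w))
  dependsOn_exo := M.dependsOn_exo_mech
  tsum_eq_one := M.tsum_mech_update

theorem isMechanism_mechDo [DecidableEq V] (M : SCM D) {Q : V → Set V}
    (hQ : ∀ w, M.pa w ⊆ Q w) {X : V} {C : Set V} (hC : C ⊆ Q X) (hX : X ∉ C) (π : Policy D X C) :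
    IsMechanism Q M.ex (M.mechDo X π) := by
  have hm := M.isMechanism_mech hQ
  have hne : ∀ w, w ≠ X → M.mechDo X π w = fun x u => M.mech x u w := fun w hw => by
    funext x u
    exact if_neg hw
  have heq : M.mechDo X π X = fun x _ => π (fun a => x a) (x X) := by
    funext x u
    exact if_pos rfl
  refine ⟨fun w x => ?_, fun w u => ?_, fun w x => ?_, fun w x u => ?_⟩ <;>
    rcases eq_or_ne w X with rfl | hw
  · rw [heq]
    exact measurable_const
  · rw [hne w hw]
    exact hm.measurable w x
  · intro x y hxy
    have h : (fun v : C => x v) = fun v : C => y v :=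
      funext fun v => hxy v (Set.mem_insert_of_mem _ (hC v.2))
    simp only [heq]
    rw [h, hxy w (Set.mem_insert _ _)]
  · rw [hne w hw]
    exact hm.dependsOn w u
  · rw [heq]
    exact fun _ _ _ => rfl
  · rw [hne w hw]
    exact hm.dependsOn_exo w x
  · have h : ∀ a, (fun v : C => Function.update x w a v) = fun v : C => x v := fun a =>
      funext fun v => Function.update_of_ne (fun hv => hX (by
        have := v.2
        rwa [hv] at this)) _ _
    simp only [heq, h, Function.update_self, PMF.tsum_coe]
  · rw [hne w hw]
    exact hm.tsum_eq_one w x u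

variable [Fintype V]

theorem joint_eq_massOf (M : SCM D) :
    M.joint = massOf M.P (fun w x u => M.mech x u w) Finset.univ := rfl

theorem jointDo_eq_massOf [DecidableEq V] (M : SCM D) (X : V) {C : Set V} (π : Policy D X C) :
    M.jointDo X π = massOf M.P (M.mechDo X π) Finset.univ := by
  funext x
  refine MeasureTheory.lintegral_congr fun u => ?_
  rw [← Finset.prod_erase_mul _ _ (Finset.mem_univ X)]
  congr 1
  · exact Finset.prod_congr rfl fun w hw => by
      simp only [mechDo, if_neg (Finset.ne_of_mem_erase hw)]
  · simp only [mechDo, if_true]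

theorem tsum_joint [DecidableEq V] [∀ w, Countable (D w)] (M : SCM D)
    [Nonempty (∀ w, D w)] : ∑' x, M.joint x = 1 := by
  rw [joint_eq_massOf]
  exact (M.isMechanism_mech fun w => subset_rfl).tsum_massOf_univ M.P M.acyclic
    (Classical.arbitrary _)

/-- The conditional distribution of `Y` given a surrogate `S` is the same with and without the
intervention. -/
theorem marginal_joint_mul_marginal_jointDo [DecidableEq V] [∀ w, Countable (D w)] (M : SCM D)
    {G : CausalDiagram V} {X Y : V} {C S : Set V} (hdir : ∀ a b, a ∈ M.pa b → G.dir a b)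
    (hbi : ∀ a b, a ≠ b → (M.ex a ∩ M.ex b).Nonempty → G.bi.Adj a b)
    (hC : G.IsPolicySpace X C) (hY : Y ∉ G.obs) (hXY : Y ∈ G.De X)
    (hS : G.IsSurrogate X Y C S) (π : Policy D X C) (t : ∀ w : ↑(insert Y S), D w) :
    marginal M.joint (insert Y S) t *
        marginal (M.jointDo X π) S (fun w => t ⟨w, Set.mem_insert_of_mem _ w.2⟩) =
      marginal (M.jointDo X π) (insert Y S) t *
        marginal M.joint S (fun w => t ⟨w, Set.mem_insert_of_mem _ w.2⟩) := by
  classical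
  have hsep := hS.2
  have hYS : some Y ∉ some '' S := by
    rintro ⟨y, hy, h⟩
    obtain rfl := Option.some.inj h
    exact hY (hS.1 hy)
  let H := G.withPolicy X C
  let Q := G.policyPa X C
  let A : Set (Option V) := H.An (insert (some Y) (some '' S))
  let N : Finset V := Finset.univ.filter fun w => some w ∉ A
  let K : Finset V := Finset.univ.filter fun w => some w ∈ H.Side (some Y) none (some '' S)
  have hmemN : ∀ w, w ∈ N ↔ some w ∉ A := fun w => by simp [N]
  have hmemK : ∀ w, w ∈ K ↔ some w ∈ H.Side (some Y) none (some '' S) := fun w => by simp [K]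
  have hB : ∀ w ∈ (K ∪ N)ᶜ, some w ∈ A ∧ some w ∉ H.Side (some Y) none (some '' S) := by
    intro w hw
    rw [Finset.mem_compl, Finset.mem_union, hmemN, hmemK] at hw
    tauto
  have hXA : some X ∈ A := by
    refine ⟨some Y, ?_, Set.mem_insert _ _⟩
    exact Relation.ReflTransGen.lift (p := H.dir) some (fun a b h => Or.inl h) _ _ hXY
  have hXK : X ∈ K := (hmemK X).2 (MixedGraph.mem_side_of_dir hsep rfl hXA)
  have hpa : ∀ w, M.pa w ⊆ Q w := fun w v hv => Or.inl (hdir v w hv)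
  have hX : X ∉ C := fun h => hC.notMem_De h Relation.ReflTransGen.refl
  have cross := fun t t' => (M.isMechanism_mech hpa).marginal_mul_marginal M.P
    (M.isMechanism_mechDo hpa (C := C) (fun c hc => Or.inr ⟨hc, rfl⟩) hX π) hC.acyclic
    (K := K) (N := N) (S := S) (T := insert Y S)
    (fun w hw => by
      funext x u
      rw [mechDo, if_neg]
      rintro rfl
      exact hw hXK)
    (fun w hw v hv hvN => by
      have hwA : some w ∈ A := by simpa [hmemN] using hw
      refine (hmemN v).1 hvN ?_
      rcases hv with rfl | hv
      · exact hwA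
      · exact MixedGraph.An_of_dir (b := some w) hv hwA)
    (Set.subset_insert _ _)
    (fun w hw hwN => (hmemN w).1 hwN (MixedGraph.subset_An _ (by
      rcases hw with rfl | hw
      · exact Set.mem_insert _ _
      · exact Set.mem_insert_of_mem _ ⟨w, hw, rfl⟩)))
    (Finset.disjoint_left.2 fun w hw hwN => (hmemN w).1 hwN ((hmemK w).1 hw).1)
    (fun w hw v hv hvT => by
      rcases hvT with rfl | hvS
      · exact absurd (CausalDiagram.fam_withPolicy hv)
          (MixedGraph.not_fam_of_mem_side hsep hYS ((hmemK w).1 hw) (by simp))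
      · exact hvS)
    (fun w hw w' hw' v hv hv' => by
      by_contra hvS
      refine (hB w' hw').2 (MixedGraph.mem_side_of_fam hsep ((hmemK w).1 hw) (by simp)
        (CausalDiagram.fam_withPolicy hv) ?_ (CausalDiagram.fam_withPolicy hv') (hB w' hw').1)
      rintro ⟨v', hv', h⟩
      exact hvS (Option.some.inj h ▸ hv'))
    (fun w hw w' hw' => by
      rw [Set.disjoint_iff_inter_eq_empty, ← Set.not_nonempty_iff_eq_empty]
      intro hne
      have hww' : w' ≠ w := by
        rintro rfl
        exact (hB w' hw').2 ((hmemK w').1 hw)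
      refine (hB w' hw').2 (MixedGraph.mem_side_of_bi hsep ((hmemK w).1 hw) ?_ (hB w' hw').1)
      exact ⟨by simpa using hww', w', w, hbi w' w hww' (by rwa [Set.inter_comm]), rfl, rfl⟩)
    t t'
  rw [← joint_eq_massOf, ← jointDo_eq_massOf] at cross
  rw [marginal_eq_tsum_marginal (M.jointDo X π) (Set.subset_insert Y S),
    marginal_eq_tsum_marginal M.joint (Set.subset_insert Y S), ← ENNReal.tsum_mul_left,
    ← ENNReal.tsum_mul_left]
  -- Both sides are sums over the configurations `t'` which agree with `t` on `S`.
  refine tsum_congr fun t' => ?_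
  simp only [mul_ite, mul_zero]
  refine if_ctx_congr Iff.rfl (fun h => ?_) fun _ => rfl
  exact cross t t' fun w hw => (h ⟨w, hw⟩).symm

end SCM

theorem POSCM.diagram_of_diagram_eq_observe {M : POSCM D} {G : CausalDiagram V} {Y : V}
    (h : M.diagram = G.observe Y) : ({ M with obs := G.obs } : POSCM D).diagram = G := by
  have h1 : M.diagram.toMixedGraph = G.toMixedGraph := congrArg (·.toMixedGraph) h
  cases G
  cases h1
  rfl

end Models
end CausalImitation

open CausalImitation

theorem mainTheorem7 {V : Type*} [Fintype V] [DecidableEq V]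
    (D : V → Type*) [∀ w, Countable (D w)]
    (G : CausalImitation.CausalDiagram V) (X Y : V)
    (hX : X ∈ G.obs) (hY : Y ∉ G.obs) (hXY : Y ∈ G.De X)
    (C : Set V) (hC : G.IsPolicySpace X C)
    (C' : Set V) (hC' : C' ⊆ C)
    (h : ∃ S : Set V, S ⊆ G.obs ∧ CausalImitation.IsInstrument D G X Y C S C') :
    CausalImitation.IsIdSubspace D (G.observe Y) X C {Y} C' := by
  obtain ⟨S, hSobs, hS, -, -, -, hid⟩ := h
  refine ⟨fun c hc => ⟨Set.mem_insert_of_mem _ (hC hc).1, (hC hc).2⟩, ?_, hC', ?_⟩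
  · exact Set.singleton_subset_iff.2 (Set.mem_insert _ _)
  intro M₁ M₂ h₁ h₂ hpos heq π
  -- If some domain is empty then all marginals are empty sums.
  rcases isEmpty_or_nonempty (∀ w, D w) with hE | hne
  · funext t
    simp [marginal]
  have hobs : G.obs ⊆ (G.observe Y).obs := Set.subset_insert _ _
  have hT : insert Y S ⊆ (G.observe Y).obs := Set.insert_subset_insert hSobs
  have hS₁₂ : marginal (M₁.jointDo X π) S = marginal (M₂.jointDo X π) S :=
    hid { M₁ with obs := G.obs } { M₂ with obs := G.obs }
      (POSCM.diagram_of_diagram_eq_observe h₁) (POSCM.diagram_of_diagram_eq_observe h₂)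
      (marginal_pos_of_subset hobs hpos) (marginal_eq_of_subset hobs heq) π
  have hmodel : ∀ M : POSCM D, M.diagram = G.observe Y → ∀ t : ∀ w : ↑(insert Y S), D w,
      marginal M.joint (insert Y S) t *
          marginal (M.jointDo X π) S (fun w => t ⟨w, Set.mem_insert_of_mem _ w.2⟩) =
        marginal (M.jointDo X π) (insert Y S) t *
          marginal M.joint S (fun w => t ⟨w, Set.mem_insert_of_mem _ w.2⟩) := by
    intro M hM t
    have hG : M.diagram.toMixedGraph = G.toMixedGraph := congrArg (·.toMixedGraph) hM
    refine M.marginal_joint_mul_marginal_jointDo (fun a b hab => ?_) (fun a b hab hu => ?_)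
      (hC.mono hC') hY hXY hS π t
    · rw [← hG]
      exact hab
    · rw [← hG]
      exact ⟨hab, hu⟩
  have hTdo : marginal (M₁.jointDo X π) (insert Y S) = marginal (M₂.jointDo X π) (insert Y S) := by
    funext t
    have e₁ := hmodel M₁ h₁ t
    have e₂ := hmodel M₂ h₂ t
    -- The products agree for both models, and the mass `P(s)` is neither zero nor infinite.
    have hle := marginal_le_tsum M₁.joint S fun w => t ⟨w, Set.mem_insert_of_mem _ w.2⟩
    rw [M₁.tsum_joint] at hle
    have h0 := marginal_pos_of_subset (hSobs.trans hobs) hpos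
      fun w => t ⟨w, Set.mem_insert_of_mem _ w.2⟩
    rw [← marginal_eq_of_subset hT heq, ← hS₁₂, ← marginal_eq_of_subset (hSobs.trans hobs) heq,
      e₁] at e₂
    exact (ENNReal.mul_left_inj h0.ne' (hle.trans_lt ENNReal.one_lt_top).ne).1 e₂
  exact marginal_eq_of_subset (Set.singleton_subset_iff.2 (Set.mem_insert _ _)) hTdo
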